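/- Let $a>0$, $0<\alpha\neq 1$, and put $\rho(x)=\alpha^2$ for $0\le x<a$, $\rho(x)=1$ for $x>a$. Let $q:[0,\infty)\to\mathbb R$ be measurable with $\int_0^\infty(1+x)|q(x)|\,dx<\infty$, and let $\alpha_i,\beta_i\in\mathbb R$ $(i=0,1,2)$ satisfy $$\alpha_0\beta_1-\alpha_1\beta_0\le 0,\qquad \alpha_0\beta_2-\alpha_2\beta_0\le 0,\qquad \alpha_1\beta_2-\alpha_2\beta_1\ge 0 .$$ Write $A(\lambda)=\alpha_0+i\alpha_1\lambda+\alpha_2\lambda^2$ and $B(\lambda)=\beta_0+i\beta_1\lambda+\beta_2\lambda^2$. Consider the equation $$-y''+q(x)y=\lambda^2\rho(x)y,\qquad 0\le x<\infty, \tag{1}$$ whose solutions are the differentiable functions $y$ with $y'$ locally absolutely continuous on $[0,\infty)$ that satisfy it almost everywhere. For every real $\lambda$, (1) has a unique solution $e(\cdot,\lambda)$ (the Jost solution) with $e^{-i\lambda x}e(x,\lambda)\to 1$ and $e^{-i\lambda x}e'(x,\lambda)\to i\lambda$ as $x\to+\infty$. Put $$E(\lambda)=B(\lambda)e'(0,\lambda)+A(\lambda)e(0,\lambda),\qquad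 S(\lambda)=\frac{B(\lambda)\overline{e'(0,\lambda)}+A(\lambda)\overline{e(0,\lambda)}}{E(\lambda)}\quad(E(\lambda)\ne0).$$ Then: (i) For every real $\lambda\neq0$ at which $A(\lambda)$ and $B(\lambda)$ do not both vanish, $E(\lambda)\ne 0$, equation (1) has a solution $w(\cdot,\lambda)$ with $w(0,\lambda)=B(\lambda)$, $w'(0,\lambda)=-A(\lambda)$, and every such solution satisfies, for all $x\ge0$, $$\frac{2i\lambda\, w(x,\lambda)}{E(\lambda)}=\overline{e(x,\lambda)}-S(\lambda)\,e(x,\lambda).$$ (ii) For every real $\lambda$, $\overline{E(\lambda)}=E(-\lambda)$; and $\overline{S(-\lambda)}=S(\lambda)$ whenever $E(\lambda)\neq0$. -/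

import Mathlib

open MeasureTheory Set Filter Topology
open scoped ComplexConjugate

noncomputable section

namespace HalfLineScattering

/-- The piecewise constant density: `α ^ 2` on `[0, a)` and `1` beyond `a`. -/
def density (a α : ℝ) (x : ℝ) : ℝ := if x < a then α ^ 2 else 1

/-- The derivative of a function on the half line `[0, ∞)`, one-sided at the endpoint `0`. -/
def halfDeriv (y : ℝ → ℂ) (x : ℝ) : ℂ := derivWithin y (Ici 0) x

/-- `y` solves `-y'' + q y = l ^ 2 ρ y` on `[0, ∞)`: `y` is differentiable, `y'` is absolutely
continuous on each `[0, b]`, and the equation holds almost everywhere on the half line. -/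
structure IsSolution (q : ℝ → ℝ) (a α : ℝ) (l : ℝ) (y : ℝ → ℂ) : Prop where
  differentiableOn : DifferentiableOn ℝ y (Ici 0)
  absolutelyContinuous : ∀ b : ℝ, 0 ≤ b → AbsolutelyContinuousOnInterval (halfDeriv y) 0 b
  equation : ∀ᵐ x ∂(volume.restrict (Ioi (0 : ℝ))), ∃ y₂ : ℂ, HasDerivAt (halfDeriv y) y₂ x ∧
    -y₂ + (q x : ℂ) * y x = (l : ℂ) ^ 2 * (density a α x : ℂ) * y x

/-- `y` is a Jost solution: a solution with `y(x) = e^{ilx} (1 + o(1))` and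
`y'(x) = e^{ilx} (il + o(1))` as `x → +∞`. -/
structure IsJostSolution (q : ℝ → ℝ) (a α : ℝ) (l : ℝ) (y : ℝ → ℂ) : Prop where
  isSolution : IsSolution q a α l y
  tendsto : Tendsto (fun x : ℝ => Complex.exp (-(Complex.I * l * x)) * y x) atTop (𝓝 1)
  tendsto_deriv : Tendsto (fun x : ℝ => Complex.exp (-(Complex.I * l * x)) * halfDeriv y x)
    atTop (𝓝 (Complex.I * l))

/-- The Jost solution `e(x, l)`. -/
def jost (q : ℝ → ℝ) (a α : ℝ) (l : ℝ) : ℝ → ℂ :=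
  Classical.epsilon (IsJostSolution q a α l)

/-- The quadratic `c₀ + i c₁ l + c₂ l ^ 2`. -/
def quad (c : Fin 3 → ℝ) (l : ℝ) : ℂ := c 0 + Complex.I * c 1 * l + c 2 * (l : ℂ) ^ 2

/-- `w` is a solution with `w(0) = β₀ + i β₁ l + β₂ l ^ 2`, `w'(0) = -(α₀ + i α₁ l + α₂ l ^ 2)`;
here `A = (α₀, α₁, α₂)` and `B = (β₀, β₁, β₂)`. -/
structure IsRegularSolution (q : ℝ → ℝ) (a α : ℝ) (A B : Fin 3 → ℝ) (l : ℝ) (w : ℝ → ℂ) :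
    Prop where
  isSolution : IsSolution q a α l w
  value_zero : w 0 = quad B l
  deriv_zero : halfDeriv w 0 = -quad A l

/-- `E(l) = (β₀ + i β₁ l + β₂ l²) e'(0, l) + (α₀ + i α₁ l + α₂ l²) e(0, l)`. -/
def jostFunction (q : ℝ → ℝ) (a α : ℝ) (A B : Fin 3 → ℝ) (l : ℝ) : ℂ :=
  quad B l * halfDeriv (jost q a α l) 0 + quad A l * jost q a α l 0

/-- The scattering function `S(l)`, meaningful where `E(l) ≠ 0`. -/
def scattering (q : ℝ → ℝ) (a α : ℝ) (A B : Fin 3 → ℝ) (l : ℝ) : ℂ :=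
  (quad B l * conj (halfDeriv (jost q a α l) 0) + quad A l * conj (jost q a α l 0)) /
    (quad B l * halfDeriv (jost q a α l) 0 + quad A l * jost q a α l 0)

end HalfLineScattering

end

noncomputable section

namespace HalfLineScattering

/-! ### Absolutely continuous functions -/

/-! Everything follows from Wronskians of `e`, its conjugate and `w`, which are constant because the
coefficients are real and (1) has no first-order term.

Since `q` and `ρ - 1` are integrable against `1 + x`, (1) perturbs `y'' = -l² y`, and variation of
constants gives a Volterra equation at infinity. In a sup norm with exponential weight its operator
is a contraction (`norm_volterra_le`), which gives existence of `e` (`exists_isJostSolution`). For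
uniqueness, two Jost solutions have Wronskian zero, hence are proportional by backward Gronwall
(`IsSolution.eq_zero_of_le`), with ratio 1 by their asymptotics.

The asymptotics also give `W(e, ē) = -2il`. If `E(l) = 0`, combining this equation with its
conjugate and taking imaginary parts makes a positive quantity vanish: `|A|² + |B|²` plus `|e(0)|² +
|e'(0)|²` times a factor that the sign conditions make nonnegative
(`IsJostSolution.boundary_ne_zero`). The initial data of `w` make `W(w, e) = E` and `W(w, ē)` the
numerator of `S`, so the formula in (i) is the linear relation among three vectors `(y, y')` in the
plane. Part (ii) holds because conjugating `e(·, l)` gives the Jost solution at `-l`. -/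

/-- A function whose increments are controlled by those of an absolutely continuous function is
absolutely continuous. -/
theorem absolutelyContinuousOnInterval_of_dist_le {X Y : Type*} [PseudoMetricSpace X]
    [PseudoMetricSpace Y] {f : ℝ → X} {g : ℝ → Y} {a b : ℝ} (K : ℝ)
    (hg : AbsolutelyContinuousOnInterval g a b)
    (h : ∀ x ∈ uIcc a b, ∀ y ∈ uIcc a b, dist (f x) (f y) ≤ K * dist (g x) (g y)) :
    AbsolutelyContinuousOnInterval f a b := by
  unfold AbsolutelyContinuousOnInterval at hg ⊢
  have hK := hg.const_mul K
  rw [mul_zero] at hK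
  refine squeeze_zero' (Eventually.of_forall fun E => Finset.sum_nonneg fun i _ => dist_nonneg)
    ?_ hK
  -- The principal part of the filter keeps all endpoints inside the interval, so the increment
  -- bound applies to every pair.
  filter_upwards [mem_inf_of_right (mem_principal_self _)] with E hE
  rw [Finset.mul_sum]
  exact Finset.sum_le_sum fun i hi => h _ (hE.1 i hi).1 _ (hE.1 i hi).2

theorem absolutelyContinuousOnInterval_integral {f : ℝ → ℂ} {a b c : ℝ}
    (hf : IntervalIntegrable f volume a b) (hc : c ∈ uIcc a b) :
    AbsolutelyContinuousOnInterval (fun x => ∫ t in c..x, f t) a b := by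
  refine absolutelyContinuousOnInterval_of_dist_le 1
    (hf.norm.absolutelyContinuousOnInterval_intervalIntegral hc) fun x hx y hy => ?_
  have hsub : ∀ u ∈ uIcc a b, IntervalIntegrable f volume c u := fun u hu =>
    hf.mono_set (uIcc_subset_uIcc hc hu)
  rw [one_mul, dist_eq_norm, dist_eq_norm,
    intervalIntegral.integral_interval_sub_left (hsub x hx) (hsub y hy),
    intervalIntegral.integral_interval_sub_left (hsub x hx).norm (hsub y hy).norm]
  exact intervalIntegral.norm_integral_le_abs_integral_norm

theorem absolutelyContinuousOnInterval_exp_comp {f : ℝ → ℝ} {a b : ℝ}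
    (hf : AbsolutelyContinuousOnInterval f a b) :
    AbsolutelyContinuousOnInterval (fun x => Real.exp (f x)) a b := by
  obtain ⟨C, hC⟩ := hf.exists_bound
  obtain ⟨K, hK⟩ := (Real.contDiff_exp (n := 1)).contDiffOn.exists_lipschitzOnWith
    (by decide) (convex_Icc (-C) C) isCompact_Icc
  exact absolutelyContinuousOnInterval_of_dist_le K hf fun x hx y hy =>
    hK.dist_le_mul _ (abs_le.1 (hC x hx)) _ (abs_le.1 (hC y hy))

/-- An absolutely continuous function with an almost everywhere prescribed derivative is an
indefinite integral. -/
theorem eq_add_integral_of_ae_hasDerivAt {F G : ℝ → ℂ} {a b : ℝ}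
    (hF : AbsolutelyContinuousOnInterval F a b) (hG : IntervalIntegrable G volume a b)
    (h : ∀ᵐ x, x ∈ uIcc a b → HasDerivAt F (G x) x) :
    ∀ x ∈ uIcc a b, F x = F a + ∫ t in a..x, G t := by
  have hd := (hF.sub (absolutelyContinuousOnInterval_integral hG left_mem_uIcc))
  obtain ⟨C, hC⟩ := hd.const_of_ae_hasDerivAt_zero (by
    filter_upwards [h, hG.ae_hasDerivAt_integral] with x hx hx' hxm
    simpa using (hx hxm).sub (hx' hxm a left_mem_uIcc))
  intro x hx
  have h1 := hC x hx
  have h2 := hC a left_mem_uIcc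
  simp only [Pi.sub_apply, intervalIntegral.integral_same, sub_zero] at h1 h2
  rw [h2, ← h1]; ring

/-- An absolutely continuous function whose derivative is almost everywhere equal to a continuous
function is everywhere differentiable. -/
theorem hasDerivAt_of_ae_hasDerivAt {F G : ℝ → ℂ}
    (hF : ∀ a b : ℝ, AbsolutelyContinuousOnInterval F a b) (hG : Continuous G)
    (h : ∀ᵐ x, HasDerivAt F (G x) x) (x : ℝ) : HasDerivAt F (G x) x := by
  have key : F = fun y => F 0 + ∫ t in (0 : ℝ)..y, G t := funext fun y =>
    eq_add_integral_of_ae_hasDerivAt (hF 0 y) (hG.intervalIntegrable _ _)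
      (h.mono fun _ hx _ => hx) y right_mem_uIcc
  rw [key]
  exact (hG.integral_hasStrictDerivAt 0 x).hasDerivAt.const_add _

/-- An absolutely continuous real function with an almost everywhere nonnegative derivative is
nondecreasing. -/
theorem le_of_ae_hasDerivAt_nonneg {F : ℝ → ℝ} {a b : ℝ} (hab : a ≤ b)
    (hF : AbsolutelyContinuousOnInterval F a b)
    (h : ∀ᵐ x, x ∈ Ioo a b → 0 ≤ deriv F x) : F a ≤ F b := by
  have h0 : 0 ≤ ∫ x in a..b, deriv F x := by
    refine intervalIntegral.integral_nonneg_of_ae_restrict hab ?_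
    rw [← restrict_Ioo_eq_restrict_Icc]
    exact (ae_restrict_iff' measurableSet_Ioo).2 h
  rw [hF.integral_deriv_eq_sub] at h0
  linarith

theorem absolutelyContinuousOnInterval_norm_sq {f : ℝ → ℂ} {a b : ℝ}
    (hf : AbsolutelyContinuousOnInterval f a b) :
    AbsolutelyContinuousOnInterval (fun x => ‖f x‖ ^ 2) a b := by
  have h : AbsolutelyContinuousOnInterval (fun x => ‖f x‖) a b :=
    absolutelyContinuousOnInterval_of_dist_le 1 hf fun x _ y _ => by
      rw [one_mul]; rw [Real.dist_eq, dist_eq_norm]; exact abs_norm_sub_norm_le _ _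
  simpa only [sq] using h.fun_mul h

/-! ### Solutions on the half line -/

section Solutions

variable {q : ℝ → ℝ} {a α l : ℝ} {y y₁ y₂ : ℝ → ℂ}

theorem halfDeriv_eq {y : ℝ → ℂ} {d : ℂ} {x : ℝ} (hx : 0 ≤ x)
    (h : HasDerivWithinAt y d (Ici 0) x) : halfDeriv y x = d :=
  h.derivWithin (uniqueDiffOn_Ici 0 x hx)

theorem halfDeriv_congr (h : EqOn y₁ y₂ (Ici 0)) {x : ℝ} (hx : 0 ≤ x) :
    halfDeriv y₁ x = halfDeriv y₂ x :=
  derivWithin_congr h (h hx)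

/-- The coefficient `q - l ^ 2 ρ` in `y'' = (q - l ^ 2 ρ) y`. -/
def coeff (q : ℝ → ℝ) (a α l : ℝ) (x : ℝ) : ℝ := q x - l ^ 2 * density a α x

theorem IsSolution.hasDerivWithinAt (h : IsSolution q a α l y) {x : ℝ} (hx : 0 ≤ x) :
    HasDerivWithinAt y (halfDeriv y x) (Ici 0) x :=
  (h.differentiableOn x hx).hasDerivWithinAt

theorem IsSolution.hasDerivAt (h : IsSolution q a α l y) {x : ℝ} (hx : 0 < x) :
    HasDerivAt y (halfDeriv y x) x :=
  (h.hasDerivWithinAt hx.le).hasDerivAt (Ici_mem_nhds hx)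

theorem IsSolution.ae_hasDerivAt (h : IsSolution q a α l y) :
    ∀ᵐ x, 0 < x → HasDerivAt (halfDeriv y) (coeff q a α l x * y x) x := by
  filter_upwards [(ae_restrict_iff' measurableSet_Ioi).1 h.equation] with x hx hx0
  obtain ⟨d, hd, he⟩ := hx hx0
  convert hd using 1
  simp only [coeff]
  push_cast
  linear_combination he

/-- The derivative is absolutely continuous, hence bounded on `[0, b]`, which makes the solution
Lipschitz there. -/
theorem IsSolution.absolutelyContinuous_self (h : IsSolution q a α l y) {b : ℝ} (hb : 0 ≤ b) :
    AbsolutelyContinuousOnInterval y 0 b := by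
  obtain ⟨C, hC⟩ := (h.absolutelyContinuous b hb).exists_bound
  rw [uIcc_of_le hb] at hC
  have : LipschitzOnWith C.toNNReal y (Icc 0 b) :=
    (convex_Icc 0 b).lipschitzOnWith_of_nnnorm_hasDerivWithin_le
      (f' := halfDeriv y)
      (fun x hx => (h.hasDerivWithinAt hx.1).mono Icc_subset_Ici_self)
      (fun x hx => by
        rw [← NNReal.coe_le_coe, coe_nnnorm]
        exact (hC x hx).trans (Real.le_coe_toNNReal C))
  rw [← uIcc_of_le hb] at this
  exact this.absolutelyContinuousOnInterval

/-- A function with given first derivative near the half line whose derivative is absolutely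
continuous and satisfies the equation almost everywhere is a solution. -/
theorem IsSolution.of_hasDerivWithinAt {y' : ℝ → ℂ}
    (h1 : ∀ x, 0 ≤ x → HasDerivWithinAt y (y' x) (Ici 0) x)
    (h2 : ∀ b, 0 ≤ b → AbsolutelyContinuousOnInterval y' 0 b)
    (h3 : ∀ᵐ x, 0 < x → HasDerivAt y' (coeff q a α l x * y x) x) :
    IsSolution q a α l y where
  differentiableOn x hx := (h1 x hx).differentiableWithinAt
  absolutelyContinuous b hb := by
    refine absolutelyContinuousOnInterval_of_dist_le 1 (h2 b hb) fun x hx z hz => ?_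
    rw [uIcc_of_le hb] at hx hz
    rw [one_mul, halfDeriv_eq hx.1 (h1 x hx.1), halfDeriv_eq hz.1 (h1 z hz.1)]
  equation := by
    refine (ae_restrict_iff' measurableSet_Ioi).2 ?_
    filter_upwards [h3] with x hx hx0
    refine ⟨_, (hx hx0).congr_of_eventuallyEq ?_, ?_⟩
    · filter_upwards [Ioi_mem_nhds hx0] with z hz
      exact halfDeriv_eq (le_of_lt hz) (h1 z (le_of_lt hz))
    · simp only [coeff]
      push_cast
      ring

theorem hasDerivWithinAt_linearCombination (h₁ : IsSolution q a α l y₁)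
    (h₂ : IsSolution q a α l y₂) (c₁ c₂ : ℂ) {x : ℝ} (hx : 0 ≤ x) :
    HasDerivWithinAt (fun t => c₁ * y₁ t + c₂ * y₂ t)
      (c₁ * halfDeriv y₁ x + c₂ * halfDeriv y₂ x) (Ici 0) x :=
  ((h₁.hasDerivWithinAt hx).const_mul c₁).add ((h₂.hasDerivWithinAt hx).const_mul c₂)

theorem IsSolution.linearCombination (h₁ : IsSolution q a α l y₁)
    (h₂ : IsSolution q a α l y₂) (c₁ c₂ : ℂ) :
    IsSolution q a α l (fun t => c₁ * y₁ t + c₂ * y₂ t) := by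
  refine .of_hasDerivWithinAt
    (fun x hx => hasDerivWithinAt_linearCombination h₁ h₂ c₁ c₂ hx)
    (fun b hb => ((h₁.absolutelyContinuous b hb).const_smul c₁).fun_add
      ((h₂.absolutelyContinuous b hb).const_smul c₂)) ?_
  filter_upwards [h₁.ae_hasDerivAt, h₂.ae_hasDerivAt] with x hx₁ hx₂ hx
  refine (((hx₁ hx).const_mul c₁).fun_add ((hx₂ hx).const_mul c₂)).congr_deriv ?_
  ring

theorem hasDerivWithinAt_conj {y : ℝ → ℂ} {d : ℂ} {s : Set ℝ} {x : ℝ}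
    (h : HasDerivWithinAt y d s x) : HasDerivWithinAt (fun t => conj (y t)) (conj d) s x :=
  Complex.conjCLE.toContinuousLinearMap.hasFDerivAt.comp_hasDerivWithinAt x h

theorem halfDeriv_conj (h : IsSolution q a α l y) {x : ℝ} (hx : 0 ≤ x) :
    halfDeriv (fun t => conj (y t)) x = conj (halfDeriv y x) :=
  halfDeriv_eq hx (hasDerivWithinAt_conj (h.hasDerivWithinAt hx))

theorem IsSolution.conj (h : IsSolution q a α l y) :
    IsSolution q a α l (fun t => conj (y t)) := by
  refine .of_hasDerivWithinAt (fun x hx => hasDerivWithinAt_conj (h.hasDerivWithinAt hx))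
    (fun b hb => absolutelyContinuousOnInterval_of_dist_le 1 (h.absolutelyContinuous b hb)
      fun x _ z _ => ?_) ?_
  · rw [one_mul, Complex.dist_conj_conj]
  · filter_upwards [h.ae_hasDerivAt] with x hx hx0
    have := hasDerivWithinAt_conj (hx hx0).hasDerivWithinAt (s := univ)
    rw [hasDerivWithinAt_univ] at this
    simpa using this

theorem IsSolution.neg_parameter (h : IsSolution q a α l y) : IsSolution q a α (-l) y where
  differentiableOn := h.differentiableOn
  absolutelyContinuous := h.absolutelyContinuous
  equation := by simpa using h.equation

/-- The Wronskian of two solutions is constant. -/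
theorem wronskian_eq (h₁ : IsSolution q a α l y₁) (h₂ : IsSolution q a α l y₂) {x : ℝ}
    (hx : 0 ≤ x) :
    y₁ x * halfDeriv y₂ x - halfDeriv y₁ x * y₂ x =
      y₁ 0 * halfDeriv y₂ 0 - halfDeriv y₁ 0 * y₂ 0 := by
  have hac : AbsolutelyContinuousOnInterval
      (fun t => y₁ t * halfDeriv y₂ t - halfDeriv y₁ t * y₂ t) 0 x :=
    ((h₁.absolutelyContinuous_self hx).fun_smul (h₂.absolutelyContinuous x hx)).fun_sub
      ((h₁.absolutelyContinuous x hx).fun_smul (h₂.absolutelyContinuous_self hx))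
  obtain ⟨C, hC⟩ := hac.const_of_ae_hasDerivAt_zero (by
    filter_upwards [h₁.ae_hasDerivAt, h₂.ae_hasDerivAt, Measure.ae_ne volume 0]
      with t ht₁ ht₂ ht0 htm
    rw [uIcc_of_le hx] at htm
    have ht : 0 < t := lt_of_le_of_ne htm.1 (Ne.symm ht0)
    refine (((h₁.hasDerivAt ht).fun_mul (ht₂ ht)).fun_sub
      ((ht₁ ht).fun_mul (h₂.hasDerivAt ht))).congr_deriv ?_
    ring)
  exact (hC x right_mem_uIcc).trans (hC 0 left_mem_uIcc).symm

/-- A solution with vanishing Cauchy data at `b` vanishes on `[0, b]`. -/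
theorem IsSolution.eq_zero_of_le (h : IsSolution q a α l y) {b : ℝ}
    (hV : IntervalIntegrable (coeff q a α l) volume 0 b)
    (h0 : y b = 0) (h1 : halfDeriv y b = 0) {x : ℝ} (hx : 0 ≤ x) (hxb : x ≤ b) : y x = 0 := by
  have hb := hx.trans hxb
  -- Backward Gronwall: with `V` the coefficient, `N' ≥ -2(1 + |V|)|y||y'| ≥ -k N`, so `N exp(∫ k)`
  -- is nondecreasing and its zero at `b` propagates to the left.
  set k : ℝ → ℝ := fun t => 1 + |coeff q a α l t| with hk
  have hki : IntervalIntegrable k volume 0 b := intervalIntegrable_const.add hV.norm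
  set N : ℝ → ℝ := fun t => ‖y t‖ ^ 2 + ‖halfDeriv y t‖ ^ 2 with hN
  set F : ℝ → ℝ := fun t => N t * Real.exp (∫ s in (0 : ℝ)..t, k s) with hF
  have hac : AbsolutelyContinuousOnInterval F 0 b :=
    ((absolutelyContinuousOnInterval_norm_sq (h.absolutelyContinuous_self hb)).fun_add
      (absolutelyContinuousOnInterval_norm_sq (h.absolutelyContinuous b hb))).fun_mul
    (absolutelyContinuousOnInterval_exp_comp
      (hki.absolutelyContinuousOnInterval_intervalIntegral left_mem_uIcc))
  have hle : F x ≤ F b := by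
    refine le_of_ae_hasDerivAt_nonneg hxb
      (hac.mono (uIcc_subset_uIcc (by rw [uIcc_of_le hb]; exact ⟨hx, hxb⟩) right_mem_uIcc)) ?_
    filter_upwards [h.ae_hasDerivAt, hki.ae_hasDerivAt_integral] with t ht htk htm
    have ht0 : 0 < t := hx.trans_lt htm.1
    have hd := ((h.hasDerivAt ht0).norm_sq.add (ht ht0).norm_sq).mul
      (htk (by rw [uIcc_of_le hb]; exact ⟨ht0.le, htm.2.le⟩) 0 left_mem_uIcc).exp
    have hd' : deriv F t = _ := hd.deriv
    rw [hd']
    have e1 := abs_le.1 (abs_real_inner_le_norm (y t) (halfDeriv y t))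
    have e2 := abs_le.1 (abs_real_inner_le_norm (halfDeriv y t) (coeff q a α l t * y t))
    rw [norm_mul, Complex.norm_real, Real.norm_eq_abs] at e2
    have e3 : 0 ≤ |coeff q a α l t| * (‖y t‖ - ‖halfDeriv y t‖) ^ 2 := by positivity
    have e4 : 0 ≤ 2 * inner ℝ (y t) (halfDeriv y t)
        + 2 * inner ℝ (halfDeriv y t) (coeff q a α l t * y t) + N t * k t := by
      simp only [hN, hk]
      nlinarith [sq_nonneg (‖y t‖ - ‖halfDeriv y t‖), e1.1, e2.1]
    have := mul_nonneg e4 (Real.exp_pos (∫ s in (0 : ℝ)..t, k s)).le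
    refine this.trans_eq ?_
    simp only [hN, Pi.add_apply]
    ring
  have hFb : F b = 0 := by simp [hF, hN, h0, h1]
  have hNx : N x ≤ 0 := by
    have := Real.exp_pos (∫ s in (0 : ℝ)..x, k s)
    rw [hFb] at hle
    exact nonpos_of_mul_nonpos_left hle this
  have : ‖y x‖ ^ 2 ≤ 0 := by
    have := sq_nonneg ‖halfDeriv y x‖
    simp only [hN] at hNx
    linarith
  simpa using le_antisymm this (sq_nonneg _)

end Solutions

/-! ### Tail integrals -/

theorem tail_integral_eq {E : Type*} [NormedAddCommGroup E] [NormedSpace ℝ E] {f : ℝ → E}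
    (hf : Integrable f) (x : ℝ) :
    ∫ t in Ioi x, f t = (∫ t in Ioi (0 : ℝ), f t) - ∫ t in (0 : ℝ)..x, f t := by
  rw [← intervalIntegral.integral_interval_add_Ioi (a := 0) (b := x) hf.integrableOn
    hf.integrableOn]
  abel

theorem continuous_tail_integral {E : Type*} [NormedAddCommGroup E] [NormedSpace ℝ E]
    {f : ℝ → E} (hf : Integrable f) : Continuous fun x => ∫ t in Ioi x, f t := by
  rw [funext (tail_integral_eq hf)]
  exact continuous_const.sub (intervalIntegral.continuous_primitive
    (fun a b => hf.intervalIntegrable) 0)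

theorem tendsto_tail_integral {E : Type*} [NormedAddCommGroup E] [NormedSpace ℝ E]
    {f : ℝ → E} (hf : Integrable f) : Tendsto (fun x => ∫ t in Ioi x, f t) atTop (𝓝 0) := by
  rw [funext (tail_integral_eq hf)]
  have := intervalIntegral_tendsto_integral_Ioi 0 hf.integrableOn tendsto_id
  simpa using this.const_sub (∫ t in Ioi (0 : ℝ), f t)

theorem ae_hasDerivAt_tail_integral {E : Type*} [NormedAddCommGroup E] [NormedSpace ℝ E]
    [CompleteSpace E] {f : ℝ → E} (hf : Integrable f) :
    ∀ᵐ x, HasDerivAt (fun x => ∫ t in Ioi x, f t) (-f x) x := by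
  rw [funext (tail_integral_eq hf)]
  filter_upwards [LocallyIntegrable.ae_hasDerivAt_integral hf.locallyIntegrable] with x hx
  exact (hx 0).const_sub _

theorem absolutelyContinuousOnInterval_tail_integral {f : ℝ → ℂ} (hf : Integrable f) (a b : ℝ) :
    AbsolutelyContinuousOnInterval (fun x => ∫ t in Ioi x, f t) a b := by
  have h := absolutelyContinuousOnInterval_integral (f := f) (a := a) (b := b) (c := a)
    hf.intervalIntegrable left_mem_uIcc
  refine absolutelyContinuousOnInterval_of_dist_le 1 h fun x _ y _ => ?_
  have e : ∀ u v : ℝ, (∫ t in Ioi u, f t) - ∫ t in Ioi v, f t = ∫ t in u..v, f t := fun u v => by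
    rw [← intervalIntegral.integral_interval_add_Ioi (a := u) (b := v) hf.integrableOn
      hf.integrableOn]
    abel
  rw [one_mul, dist_eq_norm, dist_eq_norm, e,
    intervalIntegral.integral_interval_sub_left hf.intervalIntegrable hf.intervalIntegrable,
    intervalIntegral.integral_symm, norm_neg]

/-- The weight inequality behind the contraction argument for Volterra equations at infinity. -/
theorem integral_mul_exp_tail_le {m : ℝ → ℝ} (hm : Integrable m) (hm0 : ∀ t, 0 ≤ m t) :
    Integrable (fun t => m t * Real.exp (2 * ∫ s in Ioi t, m s)) ∧
    ∀ x, ∫ t in Ioi x, m t * Real.exp (2 * ∫ s in Ioi t, m s) ≤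
      Real.exp (2 * ∫ s in Ioi x, m s) / 2 := by
  set φ : ℝ → ℝ := fun x => ∫ t in Ioi x, m t with hφ
  have hcont : Continuous φ := continuous_tail_integral hm
  have hanti : Antitone φ := fun x y hxy =>
    setIntegral_mono_set hm.integrableOn (Eventually.of_forall hm0)
      (Ioi_subset_Ioi hxy).eventuallyLE
  have hbound : ∀ x, φ x ≤ ∫ t, m t := fun x =>
    setIntegral_le_integral hm (Eventually.of_forall hm0)
  have hint : Integrable (fun t => m t * Real.exp (2 * φ t)) :=
    hm.mul_bdd (c := Real.exp (2 * ∫ t, m t)) (by fun_prop) (Eventually.of_forall fun t => by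
      rw [Real.norm_eq_abs, Real.abs_exp]
      exact Real.exp_le_exp.2 (by linarith [hbound t]))
  refine ⟨hint, fun x => ?_⟩
  refine le_of_tendsto (intervalIntegral_tendsto_integral_Ioi x hint.integrableOn tendsto_id) ?_
  filter_upwards [eventually_ge_atTop x] with b hb
  -- Almost everywhere `G'` is the integrand. Monotonicity of `G` alone bounds the integral of `G'`
  -- by the increment of `G`, which is all the inequality needs.
  set G : ℝ → ℝ := fun t => -(Real.exp (2 * φ t) / 2) with hG
  have hmono : Monotone G := fun u v huv => by
    have := Real.exp_le_exp.2 (by linarith [hanti huv] : 2 * φ v ≤ 2 * φ u)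
    simp only [hG]
    linarith
  have hmem := (hmono.monotoneOn (uIcc x b)).intervalIntegral_deriv_mem_uIcc
  rw [uIcc_of_le (by linarith [hmono hb])] at hmem
  have heq : ∫ t in x..b, deriv G t = ∫ t in x..b, m t * Real.exp (2 * φ t) := by
    refine intervalIntegral.integral_congr_ae ?_
    filter_upwards [ae_hasDerivAt_tail_integral hm] with t ht _
    have : HasDerivAt G _ t := (((ht.const_mul 2).exp).div_const 2).neg
    rw [this.deriv]
    ring
  have h2 := hmem.2
  rw [heq] at h2
  have := Real.exp_pos (2 * φ b)
  simp only [id, hG] at h2 ⊢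
  linarith

/-! ### The free sine solution -/

/-- The solution `sin (l x) / l` of `s'' = -l ^ 2 s`, equal to `x` when `l = 0`. -/
def freeSine (l x : ℝ) : ℝ := ∫ u in (0 : ℝ)..x, Real.cos (l * u)

theorem hasDerivAt_freeSine (l x : ℝ) : HasDerivAt (freeSine l) (Real.cos (l * x)) x := by
  have hc : Continuous fun u : ℝ => Real.cos (l * u) := by fun_prop
  exact (hc.integral_hasStrictDerivAt 0 x).hasDerivAt

theorem continuous_freeSine (l : ℝ) : Continuous (freeSine l) :=
  continuous_iff_continuousAt.2 fun x => (hasDerivAt_freeSine l x).continuousAt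

theorem abs_freeSine_le (l x : ℝ) : |freeSine l x| ≤ |x| := by
  have := intervalIntegral.norm_integral_le_of_norm_le_const (a := 0) (b := x)
    (f := fun u : ℝ => Real.cos (l * u)) (C := 1) fun u _ => Real.abs_cos_le_one _
  simpa [freeSine] using this

theorem mul_freeSine (l x : ℝ) : l * freeSine l x = Real.sin (l * x) := by
  rw [freeSine, intervalIntegral.mul_integral_comp_mul_left]
  simp

theorem hasDerivAt_cos_mul (l x : ℝ) :
    HasDerivAt (fun t => Real.cos (l * t)) (-(l ^ 2 * freeSine l x)) x := by
  have h := ((hasDerivAt_id x).const_mul l).cos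
  refine h.congr_deriv ?_
  rw [sq, mul_assoc, mul_freeSine]
  simp
  ring

/-! ### The Volterra equation at infinity -/

/-- The Volterra operator `f ↦ ∫_x^∞ s(t - x) Q(t) f(t) dt`, with the kernel expanded by the
addition formula. -/
def volterra (l : ℝ) (Q : ℝ → ℂ) (f : ℝ → ℂ) (x : ℝ) : ℂ :=
  Real.cos (l * x) * (∫ t in Ioi x, freeSine l t * (Q t * f t)) -
    freeSine l x * ∫ t in Ioi x, Real.cos (l * t) * (Q t * f t)

/-- The bound `|s(t)| ≤ |t|`, valid for every `l` including 0, is what calls for the weight `1 +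
|t|`. -/
theorem integrable_freeSine_mul {l : ℝ} {h : ℝ → ℂ} (hm : AEStronglyMeasurable h)
    (hh : Integrable fun t => (1 + |t|) * ‖h t‖) :
    Integrable fun t => (freeSine l t : ℂ) * h t := by
  have hc : Continuous fun t : ℝ => (freeSine l t : ℂ) :=
    Complex.continuous_ofReal.comp (continuous_freeSine l)
  refine hh.mono' (hc.aestronglyMeasurable.mul hm) (Eventually.of_forall fun t => ?_)
  rw [norm_mul, Complex.norm_real, Real.norm_eq_abs]
  gcongr
  linarith [abs_freeSine_le l t]

theorem integrable_cos_mul {l : ℝ} {h : ℝ → ℂ} (hm : AEStronglyMeasurable h)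
    (hh : Integrable fun t => (1 + |t|) * ‖h t‖) :
    Integrable fun t => (Real.cos (l * t) : ℂ) * h t := by
  have hc : Continuous fun t : ℝ => (Real.cos (l * t) : ℂ) := by fun_prop
  refine hh.mono' (hc.aestronglyMeasurable.mul hm) (Eventually.of_forall fun t => ?_)
  rw [norm_mul, Complex.norm_real, Real.norm_eq_abs]
  gcongr
  linarith [Real.abs_cos_le_one (l * t), abs_nonneg t]

theorem integrable_weight_mul {Q f : ℝ → ℂ} {C : ℝ}
    (hQi : Integrable fun t => (1 + |t|) * ‖Q t‖)
    (hQm : AEStronglyMeasurable Q) (hQ0 : ∀ t ≤ 0, Q t = 0)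
    (hf : Continuous f) (hC : ∀ t, 0 ≤ t → ‖f t‖ ≤ C) :
    Integrable fun t => (1 + |t|) * ‖Q t * f t‖ := by
  have hw : Continuous fun t : ℝ => 1 + |t| := by fun_prop
  refine (hQi.mul_const C).mono'
    (hw.aestronglyMeasurable.mul (hQm.mul hf.aestronglyMeasurable).norm)
    (Eventually.of_forall fun t => ?_)
  rw [Real.norm_of_nonneg (by positivity), norm_mul, ← mul_assoc]
  rcases le_or_gt t 0 with ht | ht
  · simp [hQ0 t ht]
  · gcongr
    exact hC t ht.le

theorem continuous_volterra {l : ℝ} {Q f : ℝ → ℂ} (hm : AEStronglyMeasurable fun t => Q t * f t)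
    (hh : Integrable fun t => (1 + |t|) * ‖Q t * f t‖) : Continuous (volterra l Q f) := by
  have h1 := continuous_tail_integral (integrable_freeSine_mul (l := l) hm hh)
  have h2 := continuous_tail_integral (integrable_cos_mul (l := l) hm hh)
  have h3 := continuous_freeSine l
  unfold volterra
  fun_prop

theorem volterra_sub {l : ℝ} {Q f g : ℝ → ℂ}
    (hmf : AEStronglyMeasurable fun t => Q t * f t)
    (hf : Integrable fun t => (1 + |t|) * ‖Q t * f t‖)
    (hmg : AEStronglyMeasurable fun t => Q t * g t)
    (hg : Integrable fun t => (1 + |t|) * ‖Q t * g t‖) (x : ℝ) :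
    volterra l Q f x - volterra l Q g x = volterra l Q (fun t => f t - g t) x := by
  simp only [volterra, mul_sub]
  rw [integral_sub (integrable_freeSine_mul hmf hf).integrableOn
      (integrable_freeSine_mul hmg hg).integrableOn,
    integral_sub (integrable_cos_mul hmf hf).integrableOn
      (integrable_cos_mul hmg hg).integrableOn]
  ring

/-- The kernel is at most `|t| + |x|`, and `0 ≤ x < t` turns this into `2(1 + |t|)`. -/
theorem norm_volterra_le_integral {l : ℝ} {Q f : ℝ → ℂ}
    (hmf : AEStronglyMeasurable fun t => Q t * f t)
    (hf : Integrable fun t => (1 + |t|) * ‖Q t * f t‖) {x : ℝ} (hx : 0 ≤ x) :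
    ‖volterra l Q f x‖ ≤ ∫ t in Ioi x, 2 * ((1 + |t|) * ‖Q t * f t‖) := by
  have hrw : volterra l Q f x = ∫ t in Ioi x,
      (Real.cos (l * x) * (freeSine l t * (Q t * f t)) -
        freeSine l x * (Real.cos (l * t) * (Q t * f t)) : ℂ) := by
    rw [integral_sub ((integrable_freeSine_mul hmf hf).integrableOn.const_mul _)
      ((integrable_cos_mul hmf hf).integrableOn.const_mul _), integral_const_mul,
      integral_const_mul]
    rfl
  rw [hrw]
  refine norm_integral_le_of_norm_le (hf.const_mul 2).integrableOn
    ((ae_restrict_iff' measurableSet_Ioi).2 (Eventually.of_forall fun t ht => ?_))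
  have ht' : x < t := ht
  have e1 : ‖(Real.cos (l * x) * freeSine l t - freeSine l x * Real.cos (l * t) : ℂ)‖ ≤
      2 * (1 + |t|) := by
    refine (norm_sub_le _ _).trans ?_
    simp only [norm_mul, Complex.norm_real, Real.norm_eq_abs]
    have a1 := mul_le_mul (Real.abs_cos_le_one (l * x)) (abs_freeSine_le l t) (abs_nonneg _)
      zero_le_one
    have a2 := mul_le_mul (abs_freeSine_le l x) (Real.abs_cos_le_one (l * t)) (abs_nonneg _)
      (abs_nonneg _)
    have a3 : |x| ≤ |t| := by rw [abs_of_nonneg hx, abs_of_pos (hx.trans_lt ht')]; exact ht'.le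
    linarith
  calc _ = ‖(Real.cos (l * x) * freeSine l t - freeSine l x * Real.cos (l * t) : ℂ)‖ *
        ‖Q t * f t‖ := by rw [← norm_mul]; congr 1; ring
    _ ≤ 2 * (1 + |t|) * ‖Q t * f t‖ := by gcongr
    _ = _ := by ring

/-- One application of the operator halves the constant in front of the exponential weight; this is
the contraction estimate. -/
theorem norm_volterra_le {l : ℝ} {Q f : ℝ → ℂ} {D : ℝ}
    (hQi : Integrable fun t => (1 + |t|) * ‖Q t‖)
    (hmf : AEStronglyMeasurable fun t => Q t * f t)
    (hf : Integrable fun t => (1 + |t|) * ‖Q t * f t‖) (hD0 : 0 ≤ D) {x : ℝ} (hx : 0 ≤ x)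
    (hD : ∀ t, x < t → ‖f t‖ ≤ D * Real.exp (2 * ∫ s in Ioi t, 2 * ((1 + |s|) * ‖Q s‖))) :
    ‖volterra l Q f x‖ ≤ D / 2 * Real.exp (2 * ∫ s in Ioi x, 2 * ((1 + |s|) * ‖Q s‖)) := by
  obtain ⟨hI, hle⟩ := integral_mul_exp_tail_le (hQi.const_mul 2) (fun t => by positivity)
  refine (norm_volterra_le_integral hmf hf hx).trans ?_
  refine (setIntegral_mono_on (hf.const_mul 2).integrableOn (hI.const_mul D).integrableOn
    measurableSet_Ioi fun t ht => ?_).trans ?_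
  · calc _ = 2 * (1 + |t|) * ‖Q t‖ * ‖f t‖ := by rw [norm_mul]; ring
      _ ≤ 2 * (1 + |t|) * ‖Q t‖ *
          (D * Real.exp (2 * ∫ s in Ioi t, 2 * ((1 + |s|) * ‖Q s‖))) := by
        gcongr
        exact hD t ht
      _ = _ := by ring
  · rw [integral_const_mul]
    have := mul_le_mul_of_nonneg_left (hle x) hD0
    linarith

/-- The Volterra equation at infinity has a solution which is bounded on the half line. -/
theorem exists_volterra_solution (l : ℝ) {Q : ℝ → ℂ}
    (hQi : Integrable fun t => (1 + |t|) * ‖Q t‖)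
    (hQm : AEStronglyMeasurable Q) (hQ0 : ∀ t ≤ 0, Q t = 0) :
    ∃ Y : ℝ → ℂ, Continuous Y ∧ (∃ C, ∀ t, 0 ≤ t → ‖Y t‖ ≤ C) ∧
      ∀ x, Y x = Complex.exp (Complex.I * l * x) + volterra l Q Y x := by
  set φ : ℝ → ℝ := fun x => ∫ s in Ioi x, 2 * ((1 + |s|) * ‖Q s‖) with hφ
  have hm := hQi.const_mul 2
  have hφc : Continuous φ := continuous_tail_integral hm
  have hφ0 : ∀ x, 0 ≤ φ x := fun x => integral_nonneg fun t => by positivity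
  have hφM : ∀ x, φ x ≤ ∫ t, 2 * ((1 + |t|) * ‖Q t‖) := fun x =>
    setIntegral_le_integral hm (Eventually.of_forall fun t => by positivity)
  set M : ℝ := Real.exp (2 * ∫ t, 2 * ((1 + |t|) * ‖Q t‖)) with hM
  -- Passing from `u` to `w u` turns the weighted norm into the ordinary sup norm, so that Banach's
  -- theorem applies to bounded continuous functions.
  set w : (BoundedContinuousFunction ℝ ℂ) → ℝ → ℂ := fun u t => Real.exp (2 * φ t) * u t with hw
  have hwc : ∀ u, Continuous (w u) := fun u => by
    have := u.continuous
    simp only [hw]; fun_prop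
  have hwle : ∀ u t, ‖w u t‖ ≤ ‖u‖ * Real.exp (2 * φ t) := fun u t => by
    rw [norm_mul, Complex.norm_real, Real.norm_of_nonneg (Real.exp_pos _).le, mul_comm]
    gcongr
    exact u.norm_coe_le_norm t
  have hwM : ∀ u t, ‖w u t‖ ≤ ‖u‖ * M := fun u t => (hwle u t).trans (by
    have := Real.exp_le_exp.2 (by linarith [hφM t] :
      2 * φ t ≤ 2 * ∫ t, 2 * ((1 + |t|) * ‖Q t‖))
    gcongr)
  have hmeas : ∀ u, AEStronglyMeasurable fun t => Q t * w u t := fun u =>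
    hQm.mul (hwc u).aestronglyMeasurable
  have hint : ∀ u, Integrable fun t => (1 + |t|) * ‖Q t * w u t‖ := fun u =>
    integrable_weight_mul hQi hQm hQ0 (hwc u) fun t _ => hwM u t
  have hexp : ∀ x : ℝ, ‖Complex.exp (Complex.I * l * x)‖ = 1 := fun x => by
    rw [show Complex.I * l * x = ((l * x : ℝ) : ℂ) * Complex.I by push_cast; ring]
    exact Complex.norm_exp_ofReal_mul_I _
  -- Replacing `x` by `max x 0` extends the map to the whole line as a constant on the left, where
  -- the kernel estimate is not available.
  set Φ : (BoundedContinuousFunction ℝ ℂ) → ℝ → ℂ := fun u x =>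
    (Real.exp (-(2 * φ (max x 0))) : ℂ) *
      (Complex.exp (Complex.I * l * (max x 0 : ℝ)) + volterra l Q (w u) (max x 0)) with hΦ
  have hΦc : ∀ u, Continuous (Φ u) := fun u => by
    have := (continuous_volterra (l := l) (hmeas u) (hint u)).comp
      (continuous_id.max continuous_const : Continuous fun x : ℝ => max x 0)
    simp only [Function.comp_def, id] at this
    simp only [hΦ]
    fun_prop
  have hvol : ∀ u (x : ℝ), 0 ≤ x →
      ‖volterra l Q (w u) x‖ ≤ ‖u‖ / 2 * Real.exp (2 * φ x) := fun u x hx =>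
    norm_volterra_le hQi (hmeas u) (hint u) (norm_nonneg u) hx fun t _ => hwle u t
  have hΦb : ∀ u x, ‖Φ u x‖ ≤ 1 + ‖u‖ / 2 := fun u x => by
    have h0 : (0 : ℝ) ≤ max x 0 := le_max_right _ _
    simp only [hΦ]
    rw [norm_mul, Complex.norm_real, Real.norm_of_nonneg (Real.exp_pos _).le]
    calc _ ≤ Real.exp (-(2 * φ (max x 0))) *
          (1 + ‖u‖ / 2 * Real.exp (2 * φ (max x 0))) := by
          gcongr
          exact (norm_add_le _ _).trans (add_le_add (hexp _).le (hvol u _ h0))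
      _ = Real.exp (-(2 * φ (max x 0))) + ‖u‖ / 2 := by
          rw [mul_add, mul_left_comm, ← Real.exp_add]; simp
      _ ≤ _ := by
          gcongr
          exact Real.exp_le_one_iff.2 (by linarith [hφ0 (max x 0)])
  set T : (BoundedContinuousFunction ℝ ℂ) → (BoundedContinuousFunction ℝ ℂ) := fun u =>
    BoundedContinuousFunction.ofNormedAddCommGroup (Φ u) (hΦc u) _ (hΦb u) with hT
  have hcontr : ContractingWith (1 / 2) T := by
    refine ⟨by rw [← NNReal.coe_lt_coe]; norm_num, LipschitzWith.of_dist_le_mul fun u v => ?_⟩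
    refine (BoundedContinuousFunction.dist_le (by positivity)).2 fun x => ?_
    have h0 : (0 : ℝ) ≤ max x 0 := le_max_right _ _
    have hd : w (u - v) = fun t => w u t - w v t := funext fun t => by
      simp only [hw, BoundedContinuousFunction.sub_apply]; ring
    have hs : T u x - T v x = (Real.exp (-(2 * φ (max x 0))) : ℂ) *
        volterra l Q (w (u - v)) (max x 0) := by
      rw [hd, ← volterra_sub (hmeas u) (hint u) (hmeas v) (hint v)]
      simp only [hT, hΦ, BoundedContinuousFunction.coe_ofNormedAddCommGroup]
      ring
    rw [dist_eq_norm, hs, norm_mul, Complex.norm_real, Real.norm_of_nonneg (Real.exp_pos _).le,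
      dist_eq_norm]
    calc _ ≤ Real.exp (-(2 * φ (max x 0))) * (‖u - v‖ / 2 * Real.exp (2 * φ (max x 0))) := by
          gcongr
          exact hvol _ _ h0
      _ = ‖u - v‖ / 2 := by rw [mul_left_comm, ← Real.exp_add]; simp
      _ = _ := by push_cast; ring
  set u := ContractingWith.fixedPoint T hcontr with hu
  have hfix : T u = u := hcontr.fixedPoint_isFixedPt
  have heq : ∀ x, 0 ≤ x →
      w u x = Complex.exp (Complex.I * l * x) + volterra l Q (w u) x := fun x hx => by
    have h1 : T u x = u x := by rw [hfix]
    have h2 : T u x = (Real.exp (-(2 * φ x)) : ℂ) *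
      (Complex.exp (Complex.I * l * x) + volterra l Q (w u) x) := by
      simp only [hT, hΦ, BoundedContinuousFunction.coe_ofNormedAddCommGroup, max_eq_left hx]
    have h3 : w u x = Real.exp (2 * φ x) * T u x := by rw [h1]
    rw [h3, h2, ← mul_assoc, ← Complex.ofReal_mul, ← Real.exp_add]
    simp
  -- The fixed point solves the equation only for `x ≥ 0`. Redefining it by the right-hand side
  -- gives a solution on all of `ℝ`, and the integrals do not change because `Q` vanishes on `(-∞,
  -- 0]`.
  set Y : ℝ → ℂ := fun x => Complex.exp (Complex.I * l * x) + volterra l Q (w u) x with hY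
  have hQY : ∀ t, Q t * w u t = Q t * Y t := fun t => by
    rcases le_or_gt t 0 with ht | ht
    · simp [hQ0 t ht]
    · rw [heq t ht.le]
  refine ⟨Y, ?_, ⟨‖u‖ * M, fun t ht => ?_⟩, fun x => ?_⟩
  · have := continuous_volterra (l := l) (hmeas u) (hint u)
    simp only [hY]; fun_prop
  · have := hwM u t
    rwa [heq t ht] at this
  · have : volterra l Q Y x = volterra l Q (w u) x := by
      simp only [volterra, hQY]
    rw [this]

/-! ### Existence of the Jost solution -/

/-- The perturbation `q - l ^ 2 (ρ - 1)` of the free equation, extended by zero. -/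
def perturbation (q : ℝ → ℝ) (a α l : ℝ) : ℝ → ℂ :=
  (Ioi (0 : ℝ)).indicator fun x => ((coeff q a α l x + l ^ 2 : ℝ) : ℂ)

theorem measurable_density (a α : ℝ) : Measurable (density a α) :=
  Measurable.ite measurableSet_Iio measurable_const measurable_const

theorem aestronglyMeasurable_perturbation {q : ℝ → ℝ} (a α l : ℝ)
    (hqm : AEMeasurable q (volume.restrict (Ioi (0 : ℝ)))) :
    AEStronglyMeasurable (perturbation q a α l) := by
  refine (aestronglyMeasurable_indicator_iff measurableSet_Ioi).2
    (AEMeasurable.aestronglyMeasurable ?_)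
  refine Complex.measurable_ofReal.comp_aemeasurable ?_
  exact (hqm.sub ((measurable_density a α).const_mul (l ^ 2)).aemeasurable).add_const _

/-- On `(0, ∞)` the perturbation differs from `q` only on `(0, a)`, and there by the constant `l² (1
- α²)`. -/
theorem integrable_perturbation {q : ℝ → ℝ} {a : ℝ} (α l : ℝ) (ha : 0 < a)
    (hqm : AEMeasurable q (volume.restrict (Ioi (0 : ℝ))))
    (hq : IntegrableOn (fun x : ℝ => (1 + x) * |q x|) (Ioi (0 : ℝ))) :
    Integrable fun t => (1 + |t|) * ‖perturbation q a α l t‖ := by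
  have h1 : Integrable ((Ioi (0 : ℝ)).indicator fun x : ℝ => (1 + x) * |q x|) :=
    (integrable_indicator_iff measurableSet_Ioi).2 hq
  have h2 : Integrable ((Icc (0 : ℝ) a).indicator fun _ : ℝ => (1 + a) * (l ^ 2 * |1 - α ^ 2|)) :=
    (integrable_indicator_iff measurableSet_Icc).2 (integrableOn_const (by simp))
  have hw : Continuous fun t : ℝ => 1 + |t| := by fun_prop
  refine (h1.add h2).mono' (hw.aestronglyMeasurable.mul
    (aestronglyMeasurable_perturbation a α l hqm).norm) (Eventually.of_forall fun t => ?_)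
  rw [Real.norm_of_nonneg (by positivity), Pi.add_apply]
  rcases le_or_gt t 0 with ht | ht
  · have e1 : perturbation q a α l t = 0 := indicator_of_notMem (by simpa using ht) _
    have e2 : (Ioi (0 : ℝ)).indicator (fun x : ℝ => (1 + x) * |q x|) t = 0 :=
      indicator_of_notMem (by simpa using ht) _
    rw [e1, e2, norm_zero, mul_zero, zero_add]
    exact indicator_nonneg (fun x _ => by positivity) _
  · have e1 : perturbation q a α l t = ((coeff q a α l t + l ^ 2 : ℝ) : ℂ) :=
      indicator_of_mem (show t ∈ Ioi (0 : ℝ) from ht) _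
    have e2 : (Ioi (0 : ℝ)).indicator (fun x : ℝ => (1 + x) * |q x|) t = (1 + t) * |q t| :=
      indicator_of_mem (show t ∈ Ioi (0 : ℝ) from ht) _
    rw [e1, e2, Complex.norm_real, Real.norm_eq_abs, abs_of_pos ht]
    unfold coeff density
    by_cases hta : t < a
    · rw [if_pos hta, indicator_of_mem (show t ∈ Icc 0 a from ⟨ht.le, hta.le⟩)]
      have e3 : |q t - l ^ 2 * α ^ 2 + l ^ 2| ≤ |q t| + l ^ 2 * |1 - α ^ 2| := by
        rw [show q t - l ^ 2 * α ^ 2 + l ^ 2 = q t + l ^ 2 * (1 - α ^ 2) by ring]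
        refine (abs_add_le _ _).trans_eq ?_
        rw [abs_mul, abs_of_nonneg (sq_nonneg l)]
      calc _ ≤ (1 + t) * (|q t| + l ^ 2 * |1 - α ^ 2|) := by gcongr
        _ = (1 + t) * |q t| + (1 + t) * (l ^ 2 * |1 - α ^ 2|) := by ring
        _ ≤ _ := by gcongr
    · rw [if_neg hta, show q t - l ^ 2 * 1 + l ^ 2 = q t by ring]
      have : 0 ≤ (Icc (0 : ℝ) a).indicator (fun _ : ℝ => (1 + a) * (l ^ 2 * |1 - α ^ 2|)) t :=
        indicator_nonneg (fun x _ => by positivity) _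
      linarith

theorem norm_exp_neg_I_mul (l x : ℝ) : ‖Complex.exp (-(Complex.I * l * x))‖ = 1 := by
  rw [show -(Complex.I * l * x) = ((-(l * x) : ℝ) : ℂ) * Complex.I by push_cast; ring]
  exact Complex.norm_exp_ofReal_mul_I _

theorem tendsto_exp_mul_of_tendsto_zero {l : ℝ} {f r : ℝ → ℂ} {c : ℂ}
    (h : ∀ x : ℝ, f x = c * Complex.exp (Complex.I * l * x) + r x) (hr : Tendsto r atTop (𝓝 0)) :
    Tendsto (fun x : ℝ => Complex.exp (-(Complex.I * l * x)) * f x) atTop (𝓝 c) := by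
  have e : (fun x : ℝ => Complex.exp (-(Complex.I * l * x)) * f x) =
      fun x : ℝ => c + Complex.exp (-(Complex.I * l * x)) * r x := funext fun x => by
    rw [h, mul_add, mul_left_comm, ← Complex.exp_add]
    simp
  rw [e]
  have hn : ∀ x : ℝ, ‖Complex.exp (-(Complex.I * l * x)) * r x‖ = ‖r x‖ := fun x => by
    rw [norm_mul, norm_exp_neg_I_mul, one_mul]
  have h0 : Tendsto (fun x : ℝ => Complex.exp (-(Complex.I * l * x)) * r x) atTop (𝓝 0) := by
    rw [tendsto_zero_iff_norm_tendsto_zero]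
    simp_rw [hn]
    exact tendsto_zero_iff_norm_tendsto_zero.1 hr
  simpa using h0.const_add c

/-- The kernel is split by the addition formula into products of `c`, `s` and the tail integrals
`P`, `R`, so differentiating the Volterra equation needs only the product rule. -/
theorem exists_isJostSolution {q : ℝ → ℝ} {a : ℝ} (α l : ℝ) (ha : 0 < a)
    (hqm : AEMeasurable q (volume.restrict (Ioi (0 : ℝ))))
    (hq : IntegrableOn (fun x : ℝ => (1 + x) * |q x|) (Ioi (0 : ℝ))) :
    ∃ y, IsJostSolution q a α l y := by
  set Q := perturbation q a α l with hQ
  have hQm := aestronglyMeasurable_perturbation a α l hqm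
  have hQi := integrable_perturbation α l ha hqm hq
  have hQ0 : ∀ t ≤ 0, Q t = 0 := fun t ht => indicator_of_notMem (by simpa using ht) _
  obtain ⟨Y, hYc, ⟨C, hYC⟩, hY⟩ := exists_volterra_solution l hQi hQm hQ0
  have hm : AEStronglyMeasurable fun t => Q t * Y t := hQm.mul hYc.aestronglyMeasurable
  have hi := integrable_weight_mul hQi hQm hQ0 hYc hYC
  have hPi := integrable_freeSine_mul (l := l) hm hi
  have hRi := integrable_cos_mul (l := l) hm hi
  set P : ℝ → ℂ := fun x => ∫ t in Ioi x, freeSine l t * (Q t * Y t) with hP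
  set R : ℝ → ℂ := fun x => ∫ t in Ioi x, Real.cos (l * t) * (Q t * Y t) with hR
  set s : ℝ → ℂ := fun x => freeSine l x with hs
  set c : ℝ → ℂ := fun x => Real.cos (l * x) with hc
  set e : ℝ → ℂ := fun x => Complex.exp (Complex.I * l * x) with he
  have hYe : Y = fun x => e x + (c x * P x - s x * R x) := funext hY
  have hsd : ∀ x, HasDerivAt s (c x) x := fun x => (hasDerivAt_freeSine l x).ofReal_comp
  have hcd : ∀ x, HasDerivAt c (-(l ^ 2 * s x)) x := fun x =>
    ((hasDerivAt_cos_mul l x).ofReal_comp).congr_deriv (by simp [hs])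
  have hed : ∀ x, HasDerivAt e (Complex.I * l * e x) x := fun x => by
    have := ((Complex.ofRealCLM.hasDerivAt (x := x)).const_mul (Complex.I * l)).cexp
    refine this.congr_deriv ?_
    simp [he]
    ring
  have hsc : Continuous s := Complex.continuous_ofReal.comp (continuous_freeSine l)
  have hcc : Continuous c := by simp only [hc]; fun_prop
  have hec : Continuous e := by simp only [he]; fun_prop
  have hPc : Continuous P := continuous_tail_integral hPi
  have hRc : Continuous R := continuous_tail_integral hRi
  have hac : ∀ {f f' : ℝ → ℂ}, (∀ x, HasDerivAt f (f' x) x) → Continuous f' →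
      ∀ u v, AbsolutelyContinuousOnInterval f u v := fun {f f'} hf hf' u v => by
    refine ContDiffOn.absolutelyContinuousOnInterval (ContDiff.contDiffOn ?_)
    refine contDiff_one_iff_deriv.2 ⟨fun x => (hf x).differentiableAt, ?_⟩
    rwa [show deriv f = f' from funext fun x => (hf x).deriv]
  have hsa := hac hsd hcc
  have hca := hac hcd (by fun_prop)
  have hea := hac hed (by fun_prop)
  have hPa := absolutelyContinuousOnInterval_tail_integral hPi
  have hRa := absolutelyContinuousOnInterval_tail_integral hRi
  -- In the derivative of `c P - s R` the contributions of `P'` and `R'` cancel. What remains is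
  -- continuous, so the derivative exists everywhere and not just almost everywhere.
  set D : ℝ → ℂ := fun x => Complex.I * l * e x + (-(l ^ 2 * (s x * P x)) - c x * R x) with hD
  have hYD : ∀ x, HasDerivAt Y (D x) x := by
    refine hasDerivAt_of_ae_hasDerivAt (fun u v => ?_) (by simp only [hD]; fun_prop) ?_
    · rw [hYe]
      exact (hea u v).fun_add (((hca u v).fun_smul (hPa u v)).fun_sub
        ((hsa u v).fun_smul (hRa u v)))
    · filter_upwards [ae_hasDerivAt_tail_integral hPi, ae_hasDerivAt_tail_integral hRi]
        with x hxP hxR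
      rw [hYe]
      refine ((hed x).fun_add (((hcd x).fun_mul hxP).fun_sub
        ((hsd x).fun_mul hxR))).congr_deriv ?_
      simp only [hD, hs, hc, hP, hR]
      ring
  have hDa : ∀ u v, AbsolutelyContinuousOnInterval D u v := fun u v =>
    ((hea u v).const_smul (Complex.I * (l : ℂ))).fun_add
      (((((hsa u v).fun_smul (hPa u v)).const_smul ((l : ℂ) ^ 2)).fun_neg).fun_sub
        ((hca u v).fun_smul (hRa u v)))
  have hpyth : ∀ x, c x ^ 2 + l ^ 2 * s x ^ 2 = 1 := fun x => by
    have := Real.sin_sq_add_cos_sq (l * x)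
    rw [← mul_freeSine] at this
    simp only [hc, hs]
    exact_mod_cast (by linarith : Real.cos (l * x) ^ 2 + l ^ 2 * freeSine l x ^ 2 = 1)
  refine ⟨Y, .of_hasDerivWithinAt (fun x _ => (hYD x).hasDerivWithinAt) (fun b _ => hDa 0 b) ?_,
    ?_, ?_⟩
  · filter_upwards [ae_hasDerivAt_tail_integral hPi, ae_hasDerivAt_tail_integral hRi]
      with x hxP hxR hx
    have hQx : Q x = ((coeff q a α l x + l ^ 2 : ℝ) : ℂ) :=
      indicator_of_mem (show x ∈ Ioi (0 : ℝ) from hx) _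
    refine (((hed x).const_mul (Complex.I * (l : ℂ))).fun_add
      ((((hsd x).fun_mul hxP).const_mul ((l : ℂ) ^ 2)).fun_neg.fun_sub
        ((hcd x).fun_mul hxR))).congr_deriv ?_
    have hQc : (coeff q a α l x : ℂ) = Q x - l ^ 2 := by rw [hQx]; push_cast; ring
    have hYx : Y x = e x + (c x * P x - s x * R x) := hY x
    rw [hQc]
    change Complex.I * l * (Complex.I * l * e x) +
      (-(l ^ 2 * (c x * P x + s x * -(s x * (Q x * Y x)))) -
        (-(l ^ 2 * s x) * R x + c x * -(c x * (Q x * Y x)))) = (Q x - l ^ 2) * Y x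
    -- Here `P'` and `R'` contribute `(c² + l² s²) Q Y = Q Y`, the perturbation term; the rest is
    -- `-l² Y`.
    linear_combination (l : ℂ) ^ 2 * e x * Complex.I_sq + Q x * Y x * hpyth x + (l : ℂ) ^ 2 * hYx
  · refine tendsto_exp_mul_of_tendsto_zero (r := volterra l Q Y) (fun x => ?_) ?_
    · rw [one_mul]; exact hY x
    · refine squeeze_zero_norm' ?_ (tendsto_tail_integral (hi.const_mul 2))
      filter_upwards [eventually_ge_atTop 0] with x hx
      exact norm_volterra_le_integral hm hi hx
  · have hcongr : (fun x : ℝ => Complex.exp (-(Complex.I * l * x)) * halfDeriv Y x) =ᶠ[atTop]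
        fun x : ℝ => Complex.exp (-(Complex.I * l * x)) * D x := by
      filter_upwards [eventually_ge_atTop 0] with x hx
      rw [halfDeriv_eq hx (hYD x).hasDerivWithinAt]
    refine Tendsto.congr' hcongr.symm ?_
    refine tendsto_exp_mul_of_tendsto_zero (fun x => rfl) ?_
    have hP0 : Tendsto (fun x => |l| * ‖P x‖ + ‖R x‖) atTop (𝓝 0) := by
      have hP' : Tendsto P atTop (𝓝 0) := tendsto_tail_integral hPi
      have hR' : Tendsto R atTop (𝓝 0) := tendsto_tail_integral hRi
      simpa using (hP'.norm.const_mul |l|).add hR'.norm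
    refine squeeze_zero_norm (fun x => ?_) hP0
    refine (norm_sub_le _ _).trans (add_le_add ?_ ?_)
    -- One factor `l` is absorbed into `l s = sin(lx)`, which stays bounded, so `P → 0` suffices.
    · have : (l : ℂ) ^ 2 * (s x * P x) = l * ((Real.sin (l * x) : ℝ) : ℂ) * P x := by
        rw [← mul_freeSine]
        push_cast
        ring
      rw [norm_neg, this, norm_mul, norm_mul, Complex.norm_real, Complex.norm_real,
        Real.norm_eq_abs, Real.norm_eq_abs]
      gcongr
      exact mul_le_of_le_one_right (abs_nonneg _) (Real.abs_sin_le_one _)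
    · rw [norm_mul]
      refine mul_le_of_le_one_left (norm_nonneg _) ?_
      simp only [hc, Complex.norm_real, Real.norm_eq_abs]
      exact Real.abs_cos_le_one _

theorem intervalIntegrable_coeff {q : ℝ → ℝ} {a : ℝ} (α l : ℝ) (ha : 0 < a)
    (hqm : AEMeasurable q (volume.restrict (Ioi (0 : ℝ))))
    (hq : IntegrableOn (fun x : ℝ => (1 + x) * |q x|) (Ioi (0 : ℝ))) {b : ℝ} (hb : 0 ≤ b) :
    IntervalIntegrable (coeff q a α l) volume 0 b := by
  rw [intervalIntegrable_iff_integrableOn_Ioc_of_le hb]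
  have hp : Integrable (perturbation q a α l) := by
    refine (integrable_perturbation α l ha hqm hq).mono'
      (aestronglyMeasurable_perturbation a α l hqm) (Eventually.of_forall fun t => ?_)
    exact le_mul_of_one_le_left (norm_nonneg _) (by linarith [abs_nonneg t])
  have hc : IntegrableOn (fun _ : ℝ => l ^ 2) (Ioc 0 b) := integrableOn_const (by simp)
  refine (hp.re.integrableOn.sub hc).congr_fun (fun x hx => ?_) measurableSet_Ioc
  have hx' : perturbation q a α l x = ((coeff q a α l x + l ^ 2 : ℝ) : ℂ) :=
    indicator_of_mem (show x ∈ Ioi (0 : ℝ) from hx.1) _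
  simp [hx', -Complex.ofReal_pow]

/-! ### Wronskians and uniqueness of Jost solutions -/

section Jost

variable {q : ℝ → ℝ} {a α l : ℝ} {y y₁ y₂ : ℝ → ℂ}

theorem IsJostSolution.wronskian_eq_zero (h₁ : IsJostSolution q a α l y₁)
    (h₂ : IsJostSolution q a α l y₂) {x : ℝ} (hx : 0 ≤ x) :
    y₁ x * halfDeriv y₂ x - halfDeriv y₁ x * y₂ x = 0 := by
  -- The factor `e^{-2ilx}` does not cancel here, so the limit is taken in norm.
  have hlim := ((h₁.tendsto.mul h₂.tendsto_deriv).sub (h₁.tendsto_deriv.mul h₂.tendsto)).norm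
  have hconst : Tendsto (fun _ : ℝ => ‖y₁ 0 * halfDeriv y₂ 0 - halfDeriv y₁ 0 * y₂ 0‖) atTop
      (𝓝 ‖1 * (Complex.I * l) - Complex.I * l * 1‖) := by
    refine hlim.congr' ?_
    filter_upwards [eventually_ge_atTop 0] with t ht
    rw [← wronskian_eq h₁.isSolution h₂.isSolution ht]
    set E := Complex.exp (-(Complex.I * l * t)) with hE
    have hn : ‖E‖ = 1 := norm_exp_neg_I_mul l t
    rw [show E * y₁ t * (E * halfDeriv y₂ t) - E * halfDeriv y₁ t * (E * y₂ t) =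
      E * E * (y₁ t * halfDeriv y₂ t - halfDeriv y₁ t * y₂ t) by ring, norm_mul, norm_mul, hn]
    ring
  have h0 := tendsto_nhds_unique tendsto_const_nhds hconst
  rw [wronskian_eq h₁.isSolution h₂.isSolution hx, ← norm_eq_zero, h0]
  simp

theorem IsJostSolution.wronskian_conj (h : IsJostSolution q a α l y) {x : ℝ} (hx : 0 ≤ x) :
    y x * conj (halfDeriv y x) - halfDeriv y x * conj (y x) = -(2 * Complex.I * l) := by
  have hconj : ∀ {f : ℝ → ℂ} {z : ℂ}, Tendsto f atTop (𝓝 z) →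
      Tendsto (fun t => conj (f t)) atTop (𝓝 (conj z)) := fun hf =>
    (Complex.continuous_conj.tendsto _).comp hf
  have hlim := (h.tendsto.mul (hconj h.tendsto_deriv)).sub (h.tendsto_deriv.mul (hconj h.tendsto))
  have hw : ∀ {t : ℝ}, 0 ≤ t → y t * conj (halfDeriv y t) - halfDeriv y t * conj (y t) =
      y 0 * conj (halfDeriv y 0) - halfDeriv y 0 * conj (y 0) := fun {t} ht => by
    have := wronskian_eq h.isSolution h.isSolution.conj ht
    rwa [halfDeriv_conj h.isSolution ht, halfDeriv_conj h.isSolution le_rfl] at this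
  have hconst : Tendsto (fun _ : ℝ => y 0 * conj (halfDeriv y 0) - halfDeriv y 0 * conj (y 0))
      atTop (𝓝 (1 * conj (Complex.I * l) - Complex.I * l * conj 1)) := by
    refine hlim.congr' ?_
    filter_upwards [eventually_ge_atTop 0] with t ht
    rw [← hw ht]
    have hn : Complex.exp (-(Complex.I * l * t)) *
        conj (Complex.exp (-(Complex.I * l * t))) = 1 := by
      rw [Complex.mul_conj, Complex.normSq_eq_norm_sq, norm_exp_neg_I_mul]
      simp
    rw [map_mul, map_mul]
    linear_combination (y t * conj (halfDeriv y t) - halfDeriv y t * conj (y t)) * hn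
  rw [hw hx, tendsto_nhds_unique tendsto_const_nhds hconst]
  simp
  ring

/-- Jost solutions are unique on the half line. -/
theorem IsJostSolution.eqOn (h₁ : IsJostSolution q a α l y₁) (h₂ : IsJostSolution q a α l y₂)
    (hV : ∀ b, 0 ≤ b → IntervalIntegrable (coeff q a α l) volume 0 b) : EqOn y₁ y₂ (Ici 0) := by
  obtain ⟨R, hR0, hR⟩ : ∃ R : ℝ, 0 ≤ R ∧ ∀ x, R ≤ x → y₂ x ≠ 0 := by
    obtain ⟨R, hR⟩ := eventually_atTop.1 (h₂.tendsto.eventually_ne one_ne_zero)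
    exact ⟨max R 0, le_max_right _ _, fun x hx h0 =>
      hR x ((le_max_left _ _).trans hx) (by rw [h0, mul_zero])⟩
  -- Scaling `y₂` matches the values at `b`; the vanishing Wronskian then matches the derivatives,
  -- and backward uniqueness gives proportionality on `[0, b]`.
  have key : ∀ b, R ≤ b → ∀ x, 0 ≤ x → x ≤ b → y₁ x = y₁ b / y₂ b * y₂ x := by
    intro b hb x hx hxb
    have hb0 := hR0.trans hb
    have hy := hR b hb
    have hz := (h₁.isSolution.linearCombination h₂.isSolution 1 (-(y₁ b / y₂ b))).eq_zero_of_le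
      (hV b hb0) (by field_simp; ring) (by
        rw [halfDeriv_eq hb0
          (hasDerivWithinAt_linearCombination h₁.isSolution h₂.isSolution _ _ hb0)]
        have hW := h₁.wronskian_eq_zero h₂ hb0
        field_simp
        linear_combination -hW) hx hxb
    linear_combination hz
  have hc : ∀ b, R ≤ b → y₁ b / y₂ b = y₁ R / y₂ R := fun b hb => by
    rw [key b hb R hR0 hb, mul_div_cancel_right₀ _ (hR R le_rfl)]
  have hone : y₁ R / y₂ R = 1 := by
    have hlim := h₂.tendsto.const_mul (y₁ R / y₂ R)
    rw [mul_one] at hlim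
    refine tendsto_nhds_unique (hlim.congr' ?_) h₁.tendsto
    filter_upwards [eventually_ge_atTop R] with x hx
    rw [key x hx x (hR0.trans hx) le_rfl, hc x hx]
    ring
  intro x hx
  have := key (max x R) (le_max_right _ _) x hx (le_max_left _ _)
  rwa [hc _ (le_max_right _ _), hone, one_mul] at this

theorem IsJostSolution.conj (h : IsJostSolution q a α l y) :
    IsJostSolution q a α (-l) (fun t => conj (y t)) := by
  have hconj : ∀ {f : ℝ → ℂ} {z : ℂ}, Tendsto f atTop (𝓝 z) →
      Tendsto (fun t => conj (f t)) atTop (𝓝 (conj z)) := fun hf =>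
    (Complex.continuous_conj.tendsto _).comp hf
  have hexp : ∀ t : ℝ, conj (Complex.exp (-(Complex.I * l * t))) =
      Complex.exp (-(Complex.I * (-l : ℝ) * t)) := fun t => by
    rw [← Complex.exp_conj]
    simp
  refine ⟨h.isSolution.conj.neg_parameter, ?_, ?_⟩
  · simpa only [map_mul, hexp, map_one] using hconj h.tendsto
  · have := hconj h.tendsto_deriv
    rw [show conj (Complex.I * (l : ℂ)) = Complex.I * (-l : ℝ) by simp] at this
    refine this.congr' ?_
    filter_upwards [eventually_ge_atTop 0] with t ht
    rw [map_mul, hexp, halfDeriv_conj h.isSolution ht]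

theorem conj_quad (c : Fin 3 → ℝ) (l : ℝ) : conj (quad c l) = quad c (-l) := by
  simp [quad]

/-- The sign conditions on the boundary coefficients exclude zeros of the Jost function. -/
theorem IsJostSolution.boundary_ne_zero {A B : Fin 3 → ℝ} (h : IsJostSolution q a α l y)
    (hδ₁ : A 0 * B 1 - A 1 * B 0 ≤ 0) (hδ₃ : 0 ≤ A 1 * B 2 - A 2 * B 1) (hl : l ≠ 0)
    (hAB : ¬ (quad A l = 0 ∧ quad B l = 0)) :
    quad B l * halfDeriv y 0 + quad A l * y 0 ≠ 0 := by
  intro hE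
  have hW := h.wronskian_conj le_rfl
  have hE' := congrArg conj hE
  simp only [map_add, map_mul, map_zero] at hE'
  -- This combination is symmetric in `A` and `B`, so no case split on which of them vanishes is
  -- needed. Its imaginary part involves only `Im(e' ē) = l` and `Im(A B̄)`.
  have hid : (quad A l * conj (quad A l) + quad B l * conj (quad B l)) *
        (halfDeriv y 0 * conj (y 0)) + quad A l * conj (quad B l) *
        (y 0 * conj (y 0) + halfDeriv y 0 * conj (halfDeriv y 0)) = 0 := by
    linear_combination (conj (quad B l) * conj (y 0)) * hE + (quad A l * halfDeriv y 0) * hE'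
  simp only [Complex.mul_conj] at hid
  have hid' := congrArg Complex.im hid
  have hW' := congrArg Complex.im hW
  have him : (quad A l * conj (quad B l)).im =
      l * (-(A 0 * B 1 - A 1 * B 0) + l ^ 2 * (A 1 * B 2 - A 2 * B 1)) := by
    simp [quad, ← Complex.ofReal_pow]
    ring
  have hl' : (halfDeriv y 0 * conj (y 0)).im = l := by
    simp at hW' ⊢
    linarith
  rw [← Complex.ofReal_add, ← Complex.ofReal_add, Complex.add_im, Complex.im_ofReal_mul,
    Complex.im_mul_ofReal, him, hl', Complex.zero_im] at hid'
  have hpos : 0 < Complex.normSq (quad A l) + Complex.normSq (quad B l) := by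
    rcases not_and_or.1 hAB with h0 | h0
    · exact add_pos_of_pos_of_nonneg (Complex.normSq_pos.2 h0) (Complex.normSq_nonneg _)
    · exact add_pos_of_nonneg_of_pos (Complex.normSq_nonneg _) (Complex.normSq_pos.2 h0)
  have hK : 0 ≤ -(A 0 * B 1 - A 1 * B 0) + l ^ 2 * (A 1 * B 2 - A 2 * B 1) :=
    add_nonneg (by linarith) (mul_nonneg (sq_nonneg l) hδ₃)
  have hN := mul_nonneg hK (add_nonneg (Complex.normSq_nonneg (y 0))
    (Complex.normSq_nonneg (halfDeriv y 0)))
  have hprod : l * (Complex.normSq (quad A l) + Complex.normSq (quad B l) +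
      (-(A 0 * B 1 - A 1 * B 0) + l ^ 2 * (A 1 * B 2 - A 2 * B 1)) *
        (Complex.normSq (y 0) + Complex.normSq (halfDeriv y 0))) = 0 := by
    linear_combination hid'
  rcases mul_eq_zero.1 hprod with h0 | h0
  · exact hl h0
  · linarith

end Jost

end HalfLineScattering

end

/-! ### The scattering identity and the symmetries -/

open HalfLineScattering in
theorem mainTheorem4
    (q : ℝ → ℝ) (a α : ℝ) (A B : Fin 3 → ℝ)
    (ha : 0 < a) (hα : 0 < α) (hα1 : α ≠ 1)
    (hqm : AEMeasurable q (volume.restrict (Ioi (0 : ℝ))))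
    (hq : IntegrableOn (fun x : ℝ => (1 + x) * |q x|) (Ioi (0 : ℝ)))
    (hδ₁ : A 0 * B 1 - A 1 * B 0 ≤ 0)
    (hδ₂ : A 0 * B 2 - A 2 * B 0 ≤ 0)
    (hδ₃ : 0 ≤ A 1 * B 2 - A 2 * B 1) :
    -- the Jost solution exists and is unique on the half line
    (∀ l : ℝ, HalfLineScattering.IsJostSolution q a α l (HalfLineScattering.jost q a α l) ∧
      ∀ y : ℝ → ℂ, HalfLineScattering.IsJostSolution q a α l y →
        EqOn y (HalfLineScattering.jost q a α l) (Ici 0)) ∧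
    (∀ l : ℝ, l ≠ 0 →
      ¬ (HalfLineScattering.quad A l = 0 ∧ HalfLineScattering.quad B l = 0) →
      HalfLineScattering.jostFunction q a α A B l ≠ 0 ∧
      (∃ w : ℝ → ℂ, HalfLineScattering.IsRegularSolution q a α A B l w) ∧
      ∀ w : ℝ → ℂ, HalfLineScattering.IsRegularSolution q a α A B l w →
        ∀ x : ℝ, 0 ≤ x →
          2 * Complex.I * l * w x / HalfLineScattering.jostFunction q a α A B l =
            conj (HalfLineScattering.jost q a α l x) -
              HalfLineScattering.scattering q a α A B l * HalfLineScattering.jost q a α l x) ∧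
    (∀ l : ℝ, conj (HalfLineScattering.jostFunction q a α A B l) =
      HalfLineScattering.jostFunction q a α A B (-l)) ∧
    (∀ l : ℝ, HalfLineScattering.jostFunction q a α A B l ≠ 0 →
      conj (HalfLineScattering.scattering q a α A B (-l)) =
        HalfLineScattering.scattering q a α A B l) := by
  have hV : ∀ l b, 0 ≤ b → IntervalIntegrable (coeff q a α l) volume 0 b := fun l b hb =>
    intervalIntegrable_coeff α l ha hqm hq hb
  have hJ : ∀ l, IsJostSolution q a α l (jost q a α l) := fun l =>
    Classical.epsilon_spec (exists_isJostSolution α l ha hqm hq)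
  -- Uniqueness identifies the two only on `[0, ∞)`: the values of `jost` at negative arguments are
  -- arbitrary.
  have hneg : ∀ l, EqOn (jost q a α (-l)) (fun t => conj (jost q a α l t)) (Ici 0) := fun l =>
    (hJ (-l)).eqOn (hJ l).conj (hV (-l))
  have hneg0 : ∀ l, jost q a α (-l) 0 = conj (jost q a α l 0) := fun l =>
    hneg l (mem_Ici.2 le_rfl)
  have hnegd : ∀ l, halfDeriv (jost q a α (-l)) 0 = conj (halfDeriv (jost q a α l) 0) := fun l => by
    rw [halfDeriv_congr (hneg l) le_rfl, halfDeriv_conj (hJ l).isSolution le_rfl]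
  refine ⟨fun l => ⟨hJ l, fun y hy => hy.eqOn (hJ l) (hV l)⟩, fun l hl hAB => ?_, fun l => ?_,
    fun l _ => ?_⟩
  · have hE : quad B l * halfDeriv (jost q a α l) 0 + quad A l * jost q a α l 0 ≠ 0 :=
      (hJ l).boundary_ne_zero hδ₁ hδ₃ hl hAB
    have hs := (hJ l).isSolution
    have hl' : 2 * Complex.I * (l : ℂ) ≠ 0 := by simp [hl]
    refine ⟨hE, ?_, fun w hw x hx => ?_⟩
    · have hW := (hJ l).wronskian_conj le_rfl
      -- The coefficients are read off the asserted formula, so `w` is built from `ē` and `e`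
      -- without solving an initial value problem; `W(e, ē)` checks the data at 0.
      set k₁ := (quad B l * halfDeriv (jost q a α l) 0 + quad A l * jost q a α l 0) /
        (2 * Complex.I * l) with hk₁
      set k₂ := -(quad B l * conj (halfDeriv (jost q a α l) 0) + quad A l * conj (jost q a α l 0)) /
        (2 * Complex.I * l) with hk₂
      refine ⟨_, hs.conj.linearCombination hs k₁ k₂, ?_, ?_⟩
      · rw [hk₁, hk₂, div_mul_eq_mul_div, div_mul_eq_mul_div, ← add_div, div_eq_iff hl']
        linear_combination -quad B l * hW
      · rw [halfDeriv_eq le_rfl (hasDerivWithinAt_linearCombination hs.conj hs k₁ k₂ le_rfl),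
          halfDeriv_conj hs le_rfl, hk₁, hk₂, div_mul_eq_mul_div, div_mul_eq_mul_div, ← add_div,
          div_eq_iff hl']
        linear_combination quad A l * hW
    · have hW := (hJ l).wronskian_conj hx
      have h₁ := wronskian_eq hw.isSolution hs hx
      have h₂ := wronskian_eq hw.isSolution hs.conj hx
      rw [halfDeriv_conj hs hx, halfDeriv_conj hs le_rfl] at h₂
      rw [hw.value_zero, hw.deriv_zero] at h₁ h₂
      rw [jostFunction, scattering, div_mul_eq_mul_div, eq_sub_iff_add_eq, ← add_div,
        div_eq_iff hE]
      -- The identity `w W(e, ē) + ē W(w, e) - e W(w, ē) = 0`, with all three Wronskians known.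
      linear_combination w x * hW + conj (jost q a α l x) * h₁ - jost q a α l x * h₂
  · simp only [jostFunction, map_add, map_mul, conj_quad, hneg0, hnegd]
  · simp only [scattering, map_div₀, map_add, map_mul, conj_quad, hneg0, hnegd, Complex.conj_conj,
      neg_neg]
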